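/- **Setting.** $\mathbb N=\{1,2,\dots\}$. A signature is a finite set of relation symbols of arities in $\mathbb N$; structures are finite with nonempty domains. A PCSP template is a pair $(\mathbb A,\mathbb B)$ of structures in the same signature with a homomorphism $\mathbb A\to\mathbb B$. A CSP instance $\mathcal I$ has a finite set of variables $x$ with finite domains $D_x$ and finitely many constraints $C=R(x_1,\dots,x_m)$ with $R\subseteq D_{x_1}\times\dots\times D_{x_m}$. A finite structure $\mathbb X$ in the signature of $\mathbb A$ is the instance whose variables are the elements of $\mathbb X$, all of whose domains are $A$, with a constraint $R^{\mathbb A}(x_1,\dots,x_m)$ for every symbol $R$ and every $(x_1,\dots,x_m)\in R^{\mathbb X}$. An algorithm *solves* $\mathrm{PCSP}(\mathbb A,\mathbb B)$ if for every finite $\mathbb X$ it returns "Yes" when $\mathbb X\to\mathbb A$ and "No" when $\mathbb X\not\to\mathbb B$. **Algorithms.** $\mathcal I^L$ is the linear system with unknowns $C^{\mathbf a}$ ($C=R(x_1,\dots,x_m)$ a constraint, $\mathbf a\in R$) and $x^b$ ($b\in D_x$) and equations $\sum_{\mathbf a\in R}C^{\mathbf a}=1$ for each $C$ and $\sum_{\mathbf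 a\in R,\ \mathbf a(i)=b}C^{\mathbf a}=x_i^b$ for each $C$, each $i\in\{1,\dots,m\}$ and $b\in D_{x_i}$. $\mathrm{BLP}+\mathrm{AIP}$ finds a solution of $\mathcal I^L$ in $\mathbb Q\cap[0,1]$ with the maximal number of nonzero values (returning "No" if there is none), removes from each constraint $C$ all tuples $\mathbf a$ with $C^{\mathbf a}=0$, and returns "Yes" iff the linear system of the resulting instance is solvable in $\mathbb Z$. $\mathrm{Singl}(\mathrm{BLP}+\mathrm{AIP})$ repeatedly picks a variable $x$ and $a\in D_x$ such that $\mathrm{BLP}+\mathrm{AIP}$ returns "No" after $D_x$ is reduced to $\{a\}$ (and tuples with another value at $x$ are dropped), and then removes $a$ from $D_x$ together with all tuples having the value $a$ at $x$; it returns "No" if some domain is empty, and "Yes" if no further removal is possible and no domain is empty. $\mathrm{CSingl}(\mathrm{BLP}+\mathrm{AIP})$ repeatedly picks a constraint $C$ and a tuple $\mathbf a$ of its relation such that $\mathrm{BLP}+\mathrm{AIP}$ returns "No" after the relation of $C$ is replaced by $\{\mathbf a\}$, and then removes $\mathbf a$ from the relation of $C$; it returns "No" if some constraint relation is empty, and "Yes"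 if no further removal is possible and no constraint relation is empty. (The removals may be made in any order; "solves" means that every run gives the required answer.) **Palette block symmetric functions.** $\mathrm{Pol}(\mathbb A,\mathbb B)$ is the set of polymorphisms, i.e. of functions $f\colon A^N\to B$ such that for every symbol $R$ applying $f$ coordinatewise to any $N$ tuples of $R^{\mathbb A}$ gives a tuple of $R^{\mathbb B}$. Let $f\colon A^{m_1+\dots+m_s}\to B$ have its arguments divided into $s$ consecutive blocks of lengths $m_1,\dots,m_s$, and let $\mathcal P$ be a set of disjoint subsets of $\{1,\dots,s\}$. A tuple $\mathbf a=(\mathbf a_1,\dots,\mathbf a_s)\in A^{m_1+\dots+m_s}$ is *palette* if for every element $c$ appearing in $\mathbf a$ there is $G\in\mathcal P$ with $\mathbf a_g=(c,\dots,c)$ for all $g\in G$. The function $f$ is *palette block symmetric* if for every $i$, $f(\mathbf a)=f(\mathbf b)$ for all palette tuples $\mathbf a,\mathbf b$ on which every function $g\colon A^{m_1+\dots+m_s}\to B$ that is symmetric in the $i$-th block takes equal values (that is, palette tuples that differ only by a permutation inside the $i$-th block). In $(\overline{m_{1,1},\dots,m_{1,k_1}},\dots,\overline{m_{n,1},\dots,m_{n,k_n}})$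 the overlines mean that $\mathcal P$ consists of the $n$ groups of blocks under a common overline. **Theorem.** Let $(\mathbb A,\mathbb B)$ be a PCSP template. The following conditions are equivalent: 1. $\mathrm{Singl}(\mathrm{BLP}+\mathrm{AIP})$ solves $\mathrm{PCSP}(\mathbb A,\mathbb B)$; 2. $\mathrm{CSingl}(\mathrm{BLP}+\mathrm{AIP})$ solves $\mathrm{PCSP}(\mathbb A,\mathbb B)$; 3. for every $\ell,n\in\mathbb N$, $\mathrm{Pol}(\mathbb A,\mathbb B)$ contains an $(\underbrace{\overline{\ell+1,\ell},\overline{\ell+1,\ell},\dots,\overline{\ell+1,\ell}}_{2n})$-palette block symmetric function ($n$ overlined groups of two blocks, of lengths $\ell+1$ and $\ell$); 4. for every $N\in\mathbb N$ there exist $n\ge N$, $k_1,\dots,k_n\in\mathbb N$ and $m_{1,1},\dots,m_{1,k_1},\dots,m_{n,1},\dots,m_{n,k_n}\ge N$ such that $\mathrm{Pol}(\mathbb A,\mathbb B)$ contains an $(\overline{m_{1,1},\dots,m_{1,k_1}},\dots,\overline{m_{n,1},\dots,m_{n,k_n}})$-palette block symmetric function. -/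

import Mathlib

open FirstOrder

/-! ### Instances of the constraint satisfaction problem -/

set_option linter.checkUnivs false in
/-- The part of a CSP instance that the algorithms never change: a finite set of variables and
a finite set of constraints, each with its arity and its list of variables. -/
structure CSPScheme.{u, v} where
  Var : Type u
  Con : Type v
  finVar : Finite Var
  finCon : Finite Con
  arity : Con → ℕ
  scope : ∀ c : Con, Fin (arity c) → Var

/-- A CSP instance with values in `V`: finite domains `D x`, and for every constraint `c` a
constraint relation `rel c` contained in the product of the domains of the variables of `c`. -/
structure CSPInstance.{u, v, w} (S : CSPScheme.{u, v}) (V : Type w) where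
  D : S.Var → Finset V
  rel : ∀ c : S.Con, Finset (Fin (S.arity c) → V)
  rel_mem : ∀ c, ∀ a ∈ rel c, ∀ i, a i ∈ D (S.scope c i)

namespace CSPInstance

universe u v w

variable {S : CSPScheme.{u, v}} {V : Type w}

open Classical in
/-- Reduce the domain of `x` to (its intersection with) `T`, and remove the tuples that use
another value at `x` from all constraints that contain `x`. -/
noncomputable def reduceDomain (I : CSPInstance S V) (x : S.Var) (T : Finset V) :
    CSPInstance S V where
  D y := if y = x then I.D y ∩ T else I.D y
  rel c := (I.rel c).filter fun a => ∀ i, S.scope c i = x → a i ∈ T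
  rel_mem c a ha i := by
    rw [Finset.mem_filter] at ha
    have h := I.rel_mem c a ha.1 i
    split_ifs with hx
    · exact Finset.mem_inter.2 ⟨h, ha.2 i hx⟩
    · exact h

open Classical in
/-- Change the constraint relation of the constraint `c` to (its intersection with) `R`. -/
noncomputable def changeConstraint (I : CSPInstance S V) (c : S.Con)
    (R : Finset (Fin (S.arity c) → V)) : CSPInstance S V where
  D := I.D
  rel := Function.update I.rel c (I.rel c ∩ R)
  rel_mem c' a ha i := by
    by_cases h : c' = c
    · subst h
      rw [Function.update_self] at ha
      exact I.rel_mem _ a (Finset.mem_inter.1 ha).1 i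
    · rw [Function.update_of_ne h] at ha
      exact I.rel_mem c' a ha i

/-! ### Linear relaxations -/

/-- An assignment of numbers to the unknowns of the linear system of an instance. The unknowns are
`con c a` for `a ∈ I.rel c` and `var x b` for `b ∈ I.D x`; the other values are irrelevant. -/
structure LinAssignment (S : CSPScheme.{u, v}) (V : Type w) (F : Type) where
  con : ∀ c : S.Con, (Fin (S.arity c) → V) → F
  var : S.Var → V → F

open Classical in
/-- `s` satisfies all equations of the linear system of `I`. -/
def IsLinSolution {F : Type} [Semiring F] (I : CSPInstance S V) (s : LinAssignment S V F) : Prop :=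
  (∀ c, ∑ a ∈ I.rel c, s.con c a = 1) ∧
  (∀ c, ∀ i : Fin (S.arity c), ∀ b ∈ I.D (S.scope c i),
    ∑ a ∈ (I.rel c).filter (fun a => a i = b), s.con c a = s.var (S.scope c i) b)

/-- A solution of the linear system in `ℚ ∩ [0, 1]`. -/
def IsBLPSolution (I : CSPInstance S V) (s : LinAssignment S V ℚ) : Prop :=
  I.IsLinSolution s ∧
  (∀ c, ∀ a ∈ I.rel c, 0 ≤ s.con c a ∧ s.con c a ≤ 1) ∧
  (∀ x, ∀ b ∈ I.D x, 0 ≤ s.var x b ∧ s.var x b ≤ 1)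

/-- AIP returns "Yes": the linear system has a solution in `ℤ`. -/
def AIP (I : CSPInstance S V) : Prop := ∃ s : LinAssignment S V ℤ, I.IsLinSolution s

/-- The number of unknowns of the linear system of `I` with a nonzero value. -/
noncomputable def numNonzero (I : CSPInstance S V) (s : LinAssignment S V ℚ) : ℕ :=
  Set.ncard {p : (c : S.Con) × (Fin (S.arity c) → V) | p.2 ∈ I.rel p.1 ∧ s.con p.1 p.2 ≠ 0} +
  Set.ncard {p : S.Var × V | p.2 ∈ I.D p.1 ∧ s.var p.1 p.2 ≠ 0}

/-- Remove from every constraint `c` all tuples `a` with `s.con c a = 0`. -/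
def prune (I : CSPInstance S V) (s : LinAssignment S V ℚ) : CSPInstance S V where
  D := I.D
  rel c := (I.rel c).filter fun a => s.con c a ≠ 0
  rel_mem c a ha i := I.rel_mem c a (Finset.mem_filter.1 ha).1 i

/-- BLP+AIP returns "Yes": there is a BLP solution, and after deleting the tuples that are zero in
a BLP solution with the maximal number of nonzero values AIP returns "Yes". (All such solutions
are nonzero at the same `con c a`, so it does not matter which one is used.) -/
def BLPplusAIP (I : CSPInstance S V) : Prop :=
  ∃ s : LinAssignment S V ℚ, I.IsBLPSolution s ∧
    (∀ t : LinAssignment S V ℚ, I.IsBLPSolution t → I.numNonzero t ≤ I.numNonzero s) ∧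
    (I.prune s).AIP

/-! ### Singleton algorithms

`Alg I` means that the algorithm `Alg` returns "Yes" on `I`. The loops of the singleton algorithms
run through the variables, values, constraints and tuples in an unspecified order; a run is a
sequence of removal steps, made in any order. -/

open Classical in
/-- One removal of `SinglAlg`: `Alg` says "No" after fixing `x` to `a`, and `a` is removed from
the domain of `x`. -/
def SinglStep (Alg : CSPInstance S V → Prop) (I J : CSPInstance S V) : Prop :=
  ∃ x, ∃ a ∈ I.D x, ¬ Alg (I.reduceDomain x {a}) ∧ J = I.reduceDomain x (I.D x \ {a})

open Classical in
/-- One removal of `CSinglAlg`: `Alg` says "No" after fixing the constraint `c` to the tuple `a`,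
and `a` is removed from the relation of `c`. -/
def CSinglStep (Alg : CSPInstance S V → Prop) (I J : CSPInstance S V) : Prop :=
  ∃ c, ∃ a ∈ I.rel c, ¬ Alg (I.changeConstraint c {a}) ∧
    J = I.changeConstraint c (I.rel c \ {a})

/-- Some run of `SinglAlg` stops with "Yes": nothing changes any more and no domain is empty. -/
def SinglYes (Alg : CSPInstance S V → Prop) (I : CSPInstance S V) : Prop :=
  ∃ J, Relation.ReflTransGen (SinglStep Alg) I J ∧ (∀ K, ¬ SinglStep Alg J K) ∧
    ∀ x, (J.D x).Nonempty

/-- Some run of `SinglAlg` stops with "No": a domain is empty. -/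
def SinglNo (Alg : CSPInstance S V → Prop) (I : CSPInstance S V) : Prop :=
  ∃ J, Relation.ReflTransGen (SinglStep Alg) I J ∧ ∃ x, J.D x = ∅

/-- Some run of `CSinglAlg` stops with "Yes": nothing changes any more and no constraint relation
is empty. -/
def CSinglYes (Alg : CSPInstance S V → Prop) (I : CSPInstance S V) : Prop :=
  ∃ J, Relation.ReflTransGen (CSinglStep Alg) I J ∧ (∀ K, ¬ CSinglStep Alg J K) ∧
    ∀ c, (J.rel c).Nonempty

/-- Some run of `CSinglAlg` stops with "No": a constraint relation is empty. -/
def CSinglNo (Alg : CSPInstance S V → Prop) (I : CSPInstance S V) : Prop :=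
  ∃ J, Relation.ReflTransGen (CSinglStep Alg) I J ∧ ∃ c, J.rel c = ∅

end CSPInstance

/-! ### Promise CSP

Structures in a finite relational signature are Mathlib's structures of a first-order language
without function symbols. -/

section PCSP

universe u v w z

/-- The variables and constraints of the instance given by a finite structure `X`: one constraint
`R(x₁, …, xₘ)` for every symbol `R` and every tuple of the relation `R` of `X`. -/
abbrev pcspScheme (L : FirstOrder.Language.{u, v}) [Finite ((n : ℕ) × L.Relations n)]
    (X : Type) [Finite X] [L.Structure X] : CSPScheme.{0, v} where
  Var := X
  Con := (R : (n : ℕ) × L.Relations n) × {x : Fin R.1 → X // FirstOrder.Language.Structure.RelMap R.2 x}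
  finVar := inferInstance
  finCon := inferInstance
  arity c := c.1.1
  scope c := c.2.1

open Classical in
/-- The instance of `CSP(A)` given by `X`: every domain is `A`, and the constraint relation of a
constraint with symbol `R` is the relation `R` of `A`. -/
noncomputable def pcspInstance (L : FirstOrder.Language.{u, v}) [Finite ((n : ℕ) × L.Relations n)]
    (A : Type w) [Fintype A] [L.Structure A] (X : Type) [Finite X] [L.Structure X] :
    CSPInstance (pcspScheme L X) A where
  D _ := Finset.univ
  rel c := Finset.univ.filter fun a : Fin c.1.1 → A => FirstOrder.Language.Structure.RelMap c.1.2 a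
  rel_mem _ _ _ _ := Finset.mem_univ _

/-- An algorithm, given by its possible answers `yes` and `no` on the instances with values in `A`,
solves `PCSP(A, B)`: on every finite `X` with `X → A` it answers "Yes" (and never "No"), and on
every finite `X` with `X ↛ B` it answers "No" (and never "Yes"). -/
def SolvesPCSP (L : FirstOrder.Language.{u, v}) [Finite ((n : ℕ) × L.Relations n)]
    (A : Type w) [Fintype A] [L.Structure A] (B : Type z) [L.Structure B]
    (yes no : ∀ {S : CSPScheme.{0, v}}, CSPInstance S A → Prop) : Prop :=
  ∀ (X : Type) [Finite X] [L.Structure X],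
    (Nonempty (X →[L] A) → yes (pcspInstance L A X) ∧ ¬ no (pcspInstance L A X)) ∧
    (IsEmpty (X →[L] B) → no (pcspInstance L A X) ∧ ¬ yes (pcspInstance L A X))

/-- `Singl(BLP+AIP)` solves `PCSP(A, B)`. -/
def SinglBLPAIPSolves (L : FirstOrder.Language.{u, v}) [Finite ((n : ℕ) × L.Relations n)]
    (A : Type w) [Fintype A] [L.Structure A] (B : Type z) [L.Structure B] : Prop :=
  SolvesPCSP L A B (CSPInstance.SinglYes CSPInstance.BLPplusAIP)
    (CSPInstance.SinglNo CSPInstance.BLPplusAIP)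

/-- `CSingl(BLP+AIP)` solves `PCSP(A, B)`. -/
def CSinglBLPAIPSolves (L : FirstOrder.Language.{u, v}) [Finite ((n : ℕ) × L.Relations n)]
    (A : Type w) [Fintype A] [L.Structure A] (B : Type z) [L.Structure B] : Prop :=
  SolvesPCSP L A B (CSPInstance.CSinglYes CSPInstance.BLPplusAIP)
    (CSPInstance.CSinglNo CSPInstance.BLPplusAIP)

/-- `f`, with arguments named by `N`, is a polymorphism from `A` to `B`. -/
def IsPolymorphism (L : FirstOrder.Language.{u, v}) {A : Type w} [L.Structure A] {B : Type z} [L.Structure B]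
    {N : Type} (f : (N → A) → B) : Prop :=
  ∀ (r : ℕ) (R : L.Relations r) (a : N → Fin r → A), (∀ i, FirstOrder.Language.Structure.RelMap R (a i)) →
    FirstOrder.Language.Structure.RelMap R (fun j => f fun i => a i j)

/-! ### Palette block symmetric functions -/

/-- Tuples divided into blocks, where the block with name `i` has length `k i`. -/
abbrev BlockTuple (A : Type w) {ι : Type} (k : ι → ℕ) : Type w := ∀ i, Fin (k i) → A

/-- A symmetric function: permuting the arguments does not change the value. -/
def IsSymmetricFun {A : Type w} {B : Type z} {n : ℕ} (h : (Fin n → A) → B) : Prop :=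
  ∀ (σ : Equiv.Perm (Fin n)) (x : Fin n → A), h (x ∘ σ) = h x

open Classical in
/-- The `i`-th block of the block function `g` is symmetric. -/
def BlockIsSymmetric {A : Type w} {B : Type z} {ι : Type} {k : ι → ℕ} (g : BlockTuple A k → B)
    (i : ι) : Prop :=
  ∀ a : BlockTuple A k, IsSymmetricFun fun x : Fin (k i) → A => g (Function.update a i x)

/-- `a` is a palette tuple for the set `P` of sets of blocks: for every element `c` of `a` there is
a set in `P` all of whose blocks in `a` are `(c, …, c)`. -/
def IsPalette {A : Type w} {ι : Type} {k : ι → ℕ} (P : Set (Set ι)) (a : BlockTuple A k) : Prop :=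
  ∀ c : A, (∃ i j, a i j = c) → ∃ G ∈ P, ∀ i ∈ G, ∀ j, a i j = c

/-- `f` is a palette block symmetric function for `P`: for every block `i`, palette tuples that are
not distinguished by the block functions whose `i`-th block is symmetric have the same image. -/
def IsPaletteBlockSymmetric {A : Type w} {B : Type z} {ι : Type} {k : ι → ℕ} (P : Set (Set ι))
    (f : BlockTuple A k → B) : Prop :=
  ∀ i : ι, ∀ a b : BlockTuple A k, IsPalette P a → IsPalette P b →
    (∀ g : BlockTuple A k → B, BlockIsSymmetric g i → g a = g b) → f a = f b

/-- `Pol(A, B)` contains a palette block symmetric function with `n` overlined groups of blocks,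
where the `i`-th group has `k i` blocks and its `j`-th block has length `m ⟨i, j⟩`. -/
def HasPaletteBlockSymmetricPol (L : FirstOrder.Language.{u, v}) (A : Type w) [L.Structure A]
    (B : Type z) [L.Structure B] (n : ℕ) (k : Fin n → ℕ) (m : (i : Fin n) × Fin (k i) → ℕ) : Prop :=
  ∃ f : BlockTuple A m → B,
    IsPolymorphism L
      (fun t : ((p : (i : Fin n) × Fin (k i)) × Fin (m p) → A) => f fun p j => t ⟨p, j⟩) ∧
    IsPaletteBlockSymmetric (Set.range fun i : Fin n => {p | p.1 = i}) f

end PCSP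

/-! From 4 to 1 and 2: let a run stop with "Yes" at an instance `J`. Then BLP+AIP accepts each
singleton restriction of `J`. Acceptance yields, for every large `m`, a list of `m` tuples per
constraint whose value counts at a variable depend only on that variable
(`BLPplusAIP.exists_tuples`): take a multiple of the BLP solution and correct its size with the AIP
solution. Let each group of blocks serve one singleton restriction, all of them being served. A
value occurring at a variable is forced in some restriction, hence constant on a group, so the
resulting block tuples are palette and the polymorphism turns them into a homomorphism
(`nonempty_hom_of_BLPplusAIP`).

From 1 or 2 to 3: make a structure out of palette tuples, related when their block counts come from
a palette matrix over `A`. Its groups provide solutions of both relaxations, and palettes guarantee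
that nothing they use is ever removed (`SingletonFamily`). So the algorithm cannot say "No", and a
homomorphism to `B` exists. It is only a partial polymorphism, respecting palette matrices
(`exists_isPartialPolymorphism`). To treat arbitrary matrices, add auxiliary groups indexed by `K`
and apply Hales-Jewett: on a monochromatic subspace the variable positions can be filled with
constant groups, which makes every matrix palette, while on palette tuples these constants are
copies of existing groups and monochromaticity preserves block symmetry
(`exists_total_of_isPartialPolymorphism`). -/

/-! ### Numbers of occurrences -/

/-- The number of occurrences of `v` in the tuple `a`. -/
noncomputable def occ {α β : Type*} (a : α → β) (v : β) : ℕ := Nat.card {k // a k = v}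

section occ

variable {α β γ : Type*}

theorem exists_perm_of_occ_eq [Finite α] {a b : α → β} (h : occ a = occ b) :
    ∃ σ : Equiv.Perm α, ∀ k, a k = b (σ k) := by
  have e : ∀ c, Nonempty ({k // a k = c} ≃ {k // b k = c}) := fun c =>
    Finite.card_eq.1 (congrFun h c)
  exact ⟨Equiv.ofFiberEquiv fun c => (e c).some, fun k =>
    (Equiv.ofFiberEquiv_map (fun c => (e c).some) k).symm⟩

theorem occ_comp_perm (a : α → β) (σ : Equiv.Perm α) : occ (a ∘ σ) = occ a := by
  funext v
  exact Nat.card_congr (σ.subtypeEquiv fun _ => Iff.rfl)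

open Classical in
theorem occ_eq_card_filter [Fintype α] (a : α → β) (v : β) :
    occ a v = (Finset.univ.filter fun k => a k = v).card := by
  rw [occ, Nat.card_eq_fintype_card, Fintype.card_subtype]

/-- A family of multiplicities is realized by a tuple. -/
theorem exists_tuple_of_multiplicity {n : ℕ} (T : Finset β) (w : β → ℕ)
    (hw : ∑ a ∈ T, w a = n) :
    ∃ g : Fin n → β, (∀ k, g k ∈ T) ∧ ∀ a ∈ T, occ g a = w a := by
  have hc : Fintype.card (Fin n) = Fintype.card (Σ a : T, Fin (w a)) := by
    rw [Fintype.card_sigma, ← hw, Fintype.card_fin, ← Finset.sum_coe_sort]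
    simp
  let e := Fintype.equivOfCardEq hc
  refine ⟨fun k => (e k).1, fun k => (e k).1.2, fun a ha => ?_⟩
  have e1 : {k // ((e k).1 : β) = a} ≃ {p : Σ a : T, Fin (w a) // p.1 = ⟨a, ha⟩} :=
    e.subtypeEquiv fun k => by rw [Subtype.ext_iff]
  rw [occ, Nat.card_congr (e1.trans (Equiv.sigmaSubtype (⟨a, ha⟩ : T))), Nat.card_fin]

open Classical in
theorem occ_comp_eq_sum {n : ℕ} (T : Finset β) (g : Fin n → β) (hg : ∀ k, g k ∈ T)
    (f : β → γ) (v : γ) :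
    occ (fun k => f (g k)) v = ∑ a ∈ T.filter (fun a => f a = v), occ g a := by
  rw [occ_eq_card_filter, Finset.card_eq_sum_card_fiberwise
    (f := g) (t := T.filter fun a => f a = v)]
  · refine Finset.sum_congr rfl fun a ha => ?_
    rw [occ_eq_card_filter]
    congr 1
    ext k
    simp only [Finset.mem_filter, Finset.mem_univ, true_and] at ha ⊢
    exact ⟨fun h => h.2, fun h => ⟨h ▸ ha.2, h⟩⟩
  · intro k hk
    simpa [hg k] using hk

end occ

/-! ### BLP+AIP -/

namespace CSPInstance

universe u v w

variable {S : CSPScheme.{u, v}} {V : Type w}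

instance : Finite S.Var := S.finVar
instance : Finite S.Con := S.finCon

/-- By nonnegativity, the average is nonzero wherever `s` or `t` is, so a solution with the most
nonzero values has the largest support. -/
theorem IsBLPSolution.midpoint {I : CSPInstance S V} {s t : LinAssignment S V ℚ}
    (hs : I.IsBLPSolution s) (ht : I.IsBLPSolution t) :
    I.IsBLPSolution ⟨fun c a => (s.con c a + t.con c a) / 2,
      fun x b => (s.var x b + t.var x b) / 2⟩ := by
  obtain ⟨⟨h1, h2⟩, h3, h4⟩ := hs
  obtain ⟨⟨k1, k2⟩, k3, k4⟩ := ht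
  refine ⟨⟨fun c => ?_, fun c i b hb => ?_⟩, fun c a ha => ?_, fun x b hb => ?_⟩
  · simp only
    rw [← Finset.sum_div, Finset.sum_add_distrib, h1, k1]
    norm_num
  · simp only
    rw [← Finset.sum_div, Finset.sum_add_distrib, h2 c i b hb, k2 c i b hb]
  · have := h3 c a ha
    have := k3 c a ha
    constructor <;> simp only <;> linarith
  · have := h4 x b hb
    have := k4 x b hb
    constructor <;> simp only <;> linarith

/-- This removes maximality from the task: the support of a maximal solution contains that of `s`,
so pruning deletes only tuples where `z` vanishes. -/
theorem BLPplusAIP_of_support [Finite V] (I : CSPInstance S V) {s : LinAssignment S V ℚ}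
    (hs : I.IsBLPSolution s) {z : LinAssignment S V ℤ} (hz : I.IsLinSolution z)
    (hsz : ∀ c, ∀ a ∈ I.rel c, z.con c a ≠ 0 → s.con c a ≠ 0) : I.BLPplusAIP := by
  classical
  have hbdd : BddAbove {k | ∃ t, I.IsBLPSolution t ∧ I.numNonzero t = k} := by
    refine ⟨Nat.card ((c : S.Con) × (Fin (S.arity c) → V)) + Nat.card (S.Var × V), ?_⟩
    rintro _ ⟨t, -, rfl⟩
    exact add_le_add (Set.ncard_le_card _) (Set.ncard_le_card _)
  obtain ⟨t, ht, htk⟩ := Nat.sSup_mem (s := {k | ∃ t, I.IsBLPSolution t ∧ I.numNonzero t = k})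
    ⟨_, s, hs, rfl⟩ hbdd
  have hmax : ∀ r, I.IsBLPSolution r → I.numNonzero r ≤ I.numNonzero t := fun r hr => by
    rw [htk]
    exact le_csSup hbdd ⟨r, hr, rfl⟩
  have hst : ∀ c, ∀ a ∈ I.rel c, s.con c a ≠ 0 → t.con c a ≠ 0 := by
    intro c a ha hsa hta
    -- The midpoint gains the constraint unknown at `a` and loses no unknown, contradicting the
    -- maximality of `t`.
    refine (hmax _ (hs.midpoint ht)).not_gt (add_lt_add_of_lt_of_le ?_ ?_)
    · refine Set.ncard_lt_ncard ⟨fun p hp => ⟨hp.1, ?_⟩, fun h => ?_⟩ (Set.toFinite _)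
      · have h1 := (hs.2.1 _ _ hp.1).1
        have h2 := lt_of_le_of_ne (ht.2.1 _ _ hp.1).1 (Ne.symm hp.2)
        simp only
        positivity
      · have h1 := lt_of_le_of_ne (hs.2.1 _ _ ha).1 (Ne.symm hsa)
        have := h (a := ⟨c, a⟩) ⟨ha, by simp only [hta]; positivity⟩
        exact this.2 hta
    · refine Set.ncard_le_ncard (fun p hp => ⟨hp.1, ?_⟩) (Set.toFinite _)
      have h1 := (hs.2.2 _ _ hp.1).1
      have h2 := lt_of_le_of_ne (ht.2.2 _ _ hp.1).1 (Ne.symm hp.2)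
      simp only
      positivity
  refine ⟨t, ht, hmax, z, fun c => ?_, fun c i b hb => ?_⟩
  · rw [← hz.1 c]
    refine Finset.sum_subset (Finset.filter_subset _ _) fun a ha hna => ?_
    by_contra h
    exact hna (Finset.mem_filter.2 ⟨ha, hst c a ha (hsz c a ha h)⟩)
  · rw [← hz.2 c i b hb]
    refine Finset.sum_subset (Finset.filter_subset_filter _ (Finset.filter_subset _ _))
      fun a ha hna => ?_
    by_contra h
    rw [Finset.mem_filter] at ha
    exact hna (Finset.mem_filter.2 ⟨Finset.mem_filter.2 ⟨ha.1, hst c a ha.1 (hsz c a ha.1 h)⟩, ha.2⟩)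

open Classical in
/-- The assignment given by weights `w` of the members `p` of an index set, where `p` stands for
the tuples `col c p` and the values `val x p`. -/
noncomputable def columnAssignment {F : Type} [Semiring F] {P : Type*} [Fintype P]
    (col : ∀ c : S.Con, P → Fin (S.arity c) → V) (val : S.Var → P → V) (w : P → F) :
    LinAssignment S V F where
  con c a := ∑ p, if col c p = a then w p else 0
  var x b := ∑ p, if val x p = b then w p else 0

/-- Exchanging sums turns a marginal into the total weight of the columns with the given value. The
permutation may vary with the constraint and coordinate, since only these totals must agree. -/
theorem isLinSolution_columnAssignment {F : Type} [Semiring F] {P : Type*} [Fintype P]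
    (I : CSPInstance S V) {col : ∀ c : S.Con, P → Fin (S.arity c) → V} {val : S.Var → P → V}
    {w : P → F} (hw : ∑ p, w p = 1) (hcol : ∀ c p, col c p ∈ I.rel c)
    (hval : ∀ c i, ∃ σ : Equiv.Perm P, (∀ p, w (σ p) = w p) ∧
      ∀ p, col c p i = val (S.scope c i) (σ p)) :
    I.IsLinSolution (columnAssignment col val w) := by
  classical
  refine ⟨fun c => ?_, fun c i b _ => ?_⟩
  · simp only [columnAssignment]
    rw [Finset.sum_comm, ← hw]
    refine Finset.sum_congr rfl fun p _ => ?_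
    rw [Finset.sum_ite_eq, if_pos (hcol c p)]
  · obtain ⟨σ, h1, h2⟩ := hval c i
    simp only [columnAssignment]
    rw [Finset.sum_comm, ← Equiv.sum_comp σ fun p => if val (S.scope c i) p = b then w p else 0]
    refine Finset.sum_congr rfl fun p _ => ?_
    rw [Finset.sum_ite_eq]
    simp only [Finset.mem_filter, hcol c p, true_and, h2 p, h1 p]

theorem BLPplusAIP_of_columns [Finite V] {P : Type*} [Fintype P]
    (I : CSPInstance S V) {col : ∀ c : S.Con, P → Fin (S.arity c) → V} {val : S.Var → P → V}
    {u : P → ℚ} {w : P → ℤ} (hu0 : ∀ p, 0 < u p) (hu : ∑ p, u p = 1) (hw : ∑ p, w p = 1)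
    (hcol : ∀ c p, col c p ∈ I.rel c)
    (hval : ∀ c i, ∃ σ : Equiv.Perm P, (∀ p, u (σ p) = u p) ∧ (∀ p, w (σ p) = w p) ∧
      ∀ p, col c p i = val (S.scope c i) (σ p)) : I.BLPplusAIP := by
  classical
  have hnonneg : ∀ (q : P → Prop) [DecidablePred q], 0 ≤ ∑ p, if q p then u p else 0 := fun q _ =>
    Finset.sum_nonneg fun p _ => by split_ifs <;> simp [(hu0 p).le]
  have hle : ∀ (q : P → Prop) [DecidablePred q], (∑ p, if q p then u p else 0) ≤ 1 := fun q _ => by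
    rw [← hu]
    exact Finset.sum_le_sum fun p _ => by split_ifs <;> simp [(hu0 p).le]
  have hs : I.IsLinSolution (columnAssignment col val u) :=
    I.isLinSolution_columnAssignment hu hcol fun c i => by
      obtain ⟨σ, h1, _, h3⟩ := hval c i
      exact ⟨σ, h1, h3⟩
  have hz : I.IsLinSolution (columnAssignment col val w) :=
    I.isLinSolution_columnAssignment hw hcol fun c i => by
      obtain ⟨σ, _, h2, h3⟩ := hval c i
      exact ⟨σ, h2, h3⟩
  have hsB : I.IsBLPSolution (columnAssignment col val u) := by
    refine ⟨hs, fun c a _ => ?_, fun x b _ => ?_⟩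
    · exact ⟨hnonneg fun p => col c p = a, hle fun p => col c p = a⟩
    · exact ⟨hnonneg fun p => val x p = b, hle fun p => val x p = b⟩
  refine I.BLPplusAIP_of_support hsB hz ?_
  · intro c a _ hz
    obtain ⟨p, -, hp⟩ := Finset.exists_ne_zero_of_sum_ne_zero hz
    have hpa : col c p = a := by
      by_contra h
      exact hp (if_neg h)
    refine ne_of_gt (Finset.sum_pos' (fun p _ => ?_) ⟨p, Finset.mem_univ p, ?_⟩)
    · split_ifs
      exacts [(hu0 p).le, le_rfl]
    · rw [if_pos hpa]
      exact hu0 p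

/-- If BLP+AIP answers "Yes", then for all large `m` there are `m` tuples of every constraint such
that the numbers of occurrences of the values of a variable do not depend on the constraint. -/
theorem BLPplusAIP.exists_tuples [Finite V] {I : CSPInstance S V} (h : I.BLPplusAIP) :
    ∃ N : ℕ, ∀ m, N ≤ m → ∃ g : ∀ c : S.Con, Fin m → Fin (S.arity c) → V,
      (∀ c k, g c k ∈ I.rel c) ∧
      ∀ c i c' i', S.scope c i = S.scope c' i' →
        occ (fun k => g c k i) = occ (fun k => g c' k i') := by
  classical
  obtain ⟨s, hs, -, z, hz⟩ := h
  have := Fintype.ofFinite S.Con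
  have := Fintype.ofFinite V
  -- common denominator
  obtain ⟨d, hd0, hd⟩ : ∃ d : ℕ, 0 < d ∧ ∀ c a, ∃ n : ℤ, (n : ℚ) = d * s.con c a := by
    refine ⟨∏ q : (c : S.Con) × (Fin (S.arity c) → V), (s.con q.1 q.2).den,
      Finset.prod_pos fun q _ => (s.con q.1 q.2).den_pos, fun c a => ?_⟩
    obtain ⟨e, he⟩ := Finset.dvd_prod_of_mem
      (fun q : (c : S.Con) × (Fin (S.arity c) → V) => (s.con q.1 q.2).den)
      (Finset.mem_univ ⟨c, a⟩)
    refine ⟨e * (s.con c a).num, ?_⟩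
    rw [he]
    have := Rat.mul_den_eq_num (s.con c a)
    push_cast
    rw [← this]
    ring
  choose n hn using hd
  -- The integer solution belongs to the pruned instance; extending it by zero keeps it supported
  -- where `n` is positive.
  let z' : ∀ c : S.Con, (Fin (S.arity c) → V) → ℤ := fun c a =>
    if s.con c a ≠ 0 then z.con c a else 0
  let Z : ℕ := ∑ q : (c : S.Con) × (Fin (S.arity c) → V), (z' q.1 q.2).natAbs
  have hZ : ∀ c a, (z' c a).natAbs ≤ Z := fun c a =>
    Finset.single_le_sum (f := fun q : (c : S.Con) × (Fin (S.arity c) → V) =>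
      (z' q.1 q.2).natAbs) (fun _ _ => Nat.zero_le _) (Finset.mem_univ ⟨c, a⟩)
  have hz1 : ∀ c, ∑ a ∈ I.rel c, z' c a = 1 := fun c => by
    rw [← Finset.sum_filter]
    exact hz.1 c
  have hz2 : ∀ c i, ∀ b ∈ I.D (S.scope c i), ∑ a ∈ (I.rel c).filter (fun a => a i = b), z' c a
      = z.var (S.scope c i) b := fun c i b hb => by
    rw [← Finset.sum_filter, Finset.filter_comm]
    exact hz.2 c i b hb
  have hn1 : ∀ c, ∑ a ∈ I.rel c, n c a = d := fun c => by
    have : (∑ a ∈ I.rel c, (n c a : ℚ)) = d := by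
      simp only [hn]
      rw [← Finset.mul_sum, hs.1.1 c, mul_one]
    exact_mod_cast this
  have hn2 : ∀ c i, ∀ b ∈ I.D (S.scope c i),
      ((∑ a ∈ (I.rel c).filter (fun a => a i = b), n c a : ℤ) : ℚ)
      = d * s.var (S.scope c i) b := fun c i b hb => by
    push_cast
    simp only [hn]
    rw [← Finset.mul_sum, hs.1.2 c i b hb]
  have hn0 : ∀ c, ∀ a ∈ I.rel c, 0 ≤ n c a := fun c a ha => by
    have : (0 : ℚ) ≤ n c a := by
      rw [hn]
      exact mul_nonneg (Nat.cast_nonneg _) (hs.2.1 c a ha).1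
    exact_mod_cast this
  -- With `m = q * d + r` and `r < d`, the multiplicities `q * n + r * z'` sum to `m`. They are
  -- nonnegative once `q ≥ d * Z`, since `|r * z'| ≤ d * Z` and `n ≥ 1` on the support.
  refine ⟨d * (d * Z), fun m hm => ?_⟩
  let W : ∀ c : S.Con, (Fin (S.arity c) → V) → ℤ := fun c a =>
    ((m / d : ℕ) : ℤ) * n c a + ((m % d : ℕ) : ℤ) * z' c a
  have hW0 : ∀ c, ∀ a ∈ I.rel c, 0 ≤ W c a := by
    intro c a ha
    by_cases h0 : s.con c a = 0
    · simp only [W, z', h0, ne_eq, not_true_eq_false, if_false, mul_zero, add_zero]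
      exact mul_nonneg (Nat.cast_nonneg _) (hn0 c a ha)
    · have h1 : 1 ≤ n c a := by
        have : n c a ≠ 0 := fun h => by
          have h2 := hn c a
          rw [h, Int.cast_zero] at h2
          rcases mul_eq_zero.1 h2.symm with h3 | h3
          · exact hd0.ne' (by exact_mod_cast h3)
          · exact h0 h3
        have := hn0 c a ha
        omega
      have h2 : d * Z ≤ m / d := by
        rw [Nat.le_div_iff_mul_le hd0, mul_comm]
        exact hm
      have h3 : (m % d) * (z' c a).natAbs ≤ d * Z :=
        Nat.mul_le_mul (Nat.mod_lt _ hd0).le (hZ c a)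
      have h4 : -(((m % d : ℕ) : ℤ) * z' c a) ≤ ((m / d : ℕ) : ℤ) := by
        have h5 : -(((m % d : ℕ) : ℤ) * z' c a) ≤ ((m % d : ℕ) : ℤ) * |z' c a| := by
          rw [← mul_neg]
          exact mul_le_mul_of_nonneg_left (neg_le_abs _) (Nat.cast_nonneg _)
        rw [Int.abs_eq_natAbs] at h5
        refine h5.trans ?_
        exact_mod_cast h3.trans h2
      have h6 : ((m / d : ℕ) : ℤ) * 1 ≤ ((m / d : ℕ) : ℤ) * n c a :=
        mul_le_mul_of_nonneg_left h1 (Nat.cast_nonneg _)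
      simp only [W]
      linarith
  have hW1 : ∀ c, ∑ a ∈ I.rel c, W c a = m := fun c => by
    simp only [W]
    rw [Finset.sum_add_distrib, ← Finset.mul_sum, ← Finset.mul_sum, hn1, hz1]
    have := Nat.div_add_mod m d
    rw [mul_one]
    exact_mod_cast (mul_comm d (m / d) ▸ this)
  have hg : ∀ c, ∃ g : Fin m → Fin (S.arity c) → V, (∀ k, g k ∈ I.rel c) ∧
      ∀ a ∈ I.rel c, (occ g a : ℤ) = W c a := by
    intro c
    obtain ⟨g, h1, h2⟩ := exists_tuple_of_multiplicity (n := m) (I.rel c)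
      (fun a => (W c a).toNat) (by
        have : ((∑ a ∈ I.rel c, (W c a).toNat : ℕ) : ℤ) = m := by
          rw [← hW1 c]
          rw [Nat.cast_sum]
          exact Finset.sum_congr rfl fun a ha => Int.toNat_of_nonneg (hW0 c a ha)
        exact_mod_cast this)
    exact ⟨g, h1, fun a ha => by rw [h2 a ha, Int.toNat_of_nonneg (hW0 c a ha)]⟩
  choose g hg1 hg2 using hg
  refine ⟨g, hg1, fun c i c' i' hcc => ?_⟩
  funext b
  have key : ∀ c i, (occ (fun k => g c k i) b : ℤ) =
      ∑ a ∈ (I.rel c).filter (fun a => a i = b), W c a := fun c i => by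
    rw [occ_comp_eq_sum (I.rel c) (g c) (hg1 c) (fun a => a i) b, Nat.cast_sum]
    exact Finset.sum_congr rfl fun a ha => hg2 c a (Finset.mem_filter.1 ha).1
  -- The right-hand side mentions `c` and `i` only through the variable `S.scope c i`.
  have key2 : ∀ c i, b ∈ I.D (S.scope c i) → (occ (fun k => g c k i) b : ℚ) =
      ((m / d : ℕ) : ℚ) * (d * s.var (S.scope c i) b) +
        ((m % d : ℕ) : ℚ) * (z.var (S.scope c i) b : ℤ) := fun c i hb => by
    rw [← hn2 c i b hb, ← hz2 c i b hb]
    have := key c i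
    simp only [W] at this
    rw [Finset.sum_add_distrib, ← Finset.mul_sum, ← Finset.mul_sum] at this
    rw [← Int.cast_natCast, this]
    push_cast
    rfl
  by_cases hb : b ∈ I.D (S.scope c i)
  · have h1 := key2 c i hb
    have h2 := key2 c' i' (hcc ▸ hb)
    rw [← hcc, ← h1] at h2
    exact_mod_cast h2.symm
  · have h0 : ∀ c i, b ∉ I.D (S.scope c i) → occ (fun k => g c k i) b = 0 := fun c i hb => by
      have := key c i
      rw [Finset.filter_false_of_mem, Finset.sum_empty] at this
      · exact_mod_cast this
      · intro a ha hab
        exact hb (hab ▸ I.rel_mem c a ha i)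
    rw [h0 c i hb, h0 c' i' (hcc ▸ hb)]

end CSPInstance

/-! ### Runs of the singleton algorithms -/

theorem Relation.ReflTransGen.exists_terminal {α : Type*} {r : α → α → Prop} (μ : α → ℕ)
    (h : ∀ a b, r a b → μ b < μ a) (a : α) : ∃ b, Relation.ReflTransGen r a b ∧ ∀ c, ¬ r b c := by
  induction hk : μ a using Nat.strong_induction_on generalizing a with
  | _ k ih =>
    by_cases hc : ∃ c, r a c
    · obtain ⟨c, hc⟩ := hc
      obtain ⟨b, h1, h2⟩ := ih _ (hk ▸ h a c hc) c rfl
      exact ⟨b, h1.head hc, h2⟩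
    · exact ⟨a, .refl, fun c hac => hc ⟨c, hac⟩⟩

namespace CSPInstance

universe u v w

variable {S : CSPScheme.{u, v}} {V : Type w} {Alg : CSPInstance S V → Prop}

theorem exists_terminal_singlStep (I : CSPInstance S V) :
    ∃ J, Relation.ReflTransGen (SinglStep Alg) I J ∧ ∀ K, ¬ SinglStep Alg J K := by
  classical
  have := Fintype.ofFinite S.Var
  refine Relation.ReflTransGen.exists_terminal (fun I => ∑ x, (I.D x).card) ?_ I
  rintro I _ ⟨x, a, ha, -, rfl⟩
  refine Finset.sum_lt_sum (fun y _ => Finset.card_le_card ?_)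
    ⟨x, Finset.mem_univ x, Finset.card_lt_card ?_⟩
  · simp only [reduceDomain]
    split_ifs
    exacts [Finset.inter_subset_left, subset_rfl]
  · simp only [reduceDomain, if_true]
    refine ⟨Finset.inter_subset_left, fun h => ?_⟩
    simpa using h ha

theorem exists_terminal_cSinglStep (I : CSPInstance S V) :
    ∃ J, Relation.ReflTransGen (CSinglStep Alg) I J ∧ ∀ K, ¬ CSinglStep Alg J K := by
  classical
  have := Fintype.ofFinite S.Con
  refine Relation.ReflTransGen.exists_terminal (fun I => ∑ c, (I.rel c).card) ?_ I
  rintro I _ ⟨c, a, ha, -, rfl⟩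
  refine Finset.sum_lt_sum (fun c' _ => Finset.card_le_card ?_)
    ⟨c, Finset.mem_univ c, Finset.card_lt_card ?_⟩
  · by_cases h : c' = c
    · subst h
      simp [changeConstraint]
    · simp [changeConstraint, h]
  · simp only [changeConstraint, Function.update_self]
    refine ⟨Finset.inter_subset_left, fun h => ?_⟩
    simpa using h ha

theorem rel_subset_of_singlSteps {I J : CSPInstance S V}
    (h : Relation.ReflTransGen (SinglStep Alg) I J) (c : S.Con) : J.rel c ⊆ I.rel c := by
  classical
  induction h with
  | refl => exact subset_rfl
  | tail _ hs ih =>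
    obtain ⟨x, a, -, -, rfl⟩ := hs
    exact (Finset.filter_subset _ _).trans ih

theorem changeConstraint_rel_subset (I : CSPInstance S V) (c c' : S.Con)
    (R : Finset (Fin (S.arity c) → V)) : (I.changeConstraint c R).rel c' ⊆ I.rel c' := by
  by_cases h : c' = c
  · subst h
    simp [changeConstraint]
  · simp [changeConstraint, h]

theorem rel_subset_of_cSinglSteps {I J : CSPInstance S V}
    (h : Relation.ReflTransGen (CSinglStep Alg) I J) (c : S.Con) : J.rel c ⊆ I.rel c := by
  induction h with
  | refl => exact subset_rfl
  | tail _ hs ih =>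
    obtain ⟨c', a, -, -, rfl⟩ := hs
    exact (changeConstraint_rel_subset _ _ _ _).trans ih

/-- A family, indexed by `ι`, of solutions of the linear relaxations: the member `g` is given by
the tuples `col g c p` and values `val g x p` for `p : P`, with weights `u p` for BLP and `w p` for
AIP, and every tuple and every value that occurs is the only one in some member. -/
structure SingletonFamily (S : CSPScheme.{u, v}) (V : Type w) (ι P : Type*) [Fintype P] where
  col : ι → ∀ c : S.Con, P → Fin (S.arity c) → V
  val : ι → S.Var → P → V
  u : P → ℚ
  w : P → ℤ
  u_pos : ∀ p, 0 < u p
  sum_u : ∑ p, u p = 1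
  sum_w : ∑ p, w p = 1
  col_eq_val : ∀ g c i, ∃ σ : Equiv.Perm P, (∀ p, u (σ p) = u p) ∧ (∀ p, w (σ p) = w p) ∧
    ∀ p, col g c p i = val g (S.scope c i) (σ p)
  val_const : ∀ x g p, ∃ g', ∀ q, val g' x q = val g x p
  col_const : ∀ c g p, ∃ g', ∀ q, col g' c q = col g c p

namespace SingletonFamily

variable {ι P : Type*} [Fintype P]

/-- All tuples and values of the family belong to the instance `I`. -/
def Inside (F : SingletonFamily S V ι P) (I : CSPInstance S V) : Prop :=
  (∀ g x p, F.val g x p ∈ I.D x) ∧ ∀ g c p, F.col g c p ∈ I.rel c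

theorem BLPplusAIP [Finite V] (F : SingletonFamily S V ι P) (g : ι) {I : CSPInstance S V}
    (h : ∀ c p, F.col g c p ∈ I.rel c) : I.BLPplusAIP :=
  I.BLPplusAIP_of_columns F.u_pos F.sum_u F.sum_w h (F.col_eq_val g)

/-- A value used at `x` is the only value at `x` in some member. That member survives fixing `x` to
it and makes BLP+AIP say "Yes", so the value is not removed. -/
theorem Inside.singlStep [Finite V] {F : SingletonFamily S V ι P} {I J : CSPInstance S V}
    (hF : F.Inside I) (h : SinglStep CSPInstance.BLPplusAIP I J) : F.Inside J := by
  classical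
  obtain ⟨x, a, -, hn, rfl⟩ := h
  have hne : ∀ g p, F.val g x p ≠ a := by
    intro g p hgp
    obtain ⟨g', hg'⟩ := F.val_const x g p
    refine hn (F.BLPplusAIP g' fun c q => Finset.mem_filter.2 ⟨hF.2 g' c q, fun i hi => ?_⟩)
    obtain ⟨σ, -, -, hσ⟩ := F.col_eq_val g' c i
    rw [hσ, hi, hg', hgp, Finset.mem_singleton]
  refine ⟨fun g y p => ?_, fun g c p => Finset.mem_filter.2 ⟨hF.2 g c p, fun i hi => ?_⟩⟩
  · simp only [reduceDomain]
    split_ifs with hy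
    · subst hy
      simp [hF.1 g y p, hne g p]
    · exact hF.1 g y p
  · obtain ⟨σ, -, -, hσ⟩ := F.col_eq_val g c i
    rw [hσ, hi]
    simp [hF.1 g x, hne g]

theorem Inside.cSinglStep [Finite V] {F : SingletonFamily S V ι P} {I J : CSPInstance S V}
    (hF : F.Inside I) (h : CSinglStep CSPInstance.BLPplusAIP I J) : F.Inside J := by
  classical
  obtain ⟨c, a, -, hn, rfl⟩ := h
  have hne : ∀ g p, F.col g c p ≠ a := by
    intro g p hgp
    obtain ⟨g', hg'⟩ := F.col_const c g p
    refine hn (F.BLPplusAIP g' fun c' q => ?_)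
    by_cases hc : c' = c
    · subst hc
      have := hF.2 g' c' q
      simp only [changeConstraint, Function.update_self]
      simp [hg', hgp] at this ⊢
      exact this
    · simpa [changeConstraint, hc] using hF.2 g' c' q
  refine ⟨hF.1, fun g c' p => ?_⟩
  by_cases hc : c' = c
  · subst hc
    simp [changeConstraint, hF.2 g c' p, hne g p]
  · simpa [changeConstraint, hc] using hF.2 g c' p

theorem nonempty_index (F : SingletonFamily S V ι P) : Nonempty P := by
  by_contra h
  rw [not_nonempty_iff] at h
  simpa using F.sum_u

variable [Finite V] [Nonempty ι] {F : SingletonFamily S V ι P} {I J : CSPInstance S V}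

theorem Inside.domain_nonempty (hF : F.Inside I)
    (h : Relation.ReflTransGen (SinglStep CSPInstance.BLPplusAIP) I J) (x : S.Var) :
    (J.D x).Nonempty := by
  have hJ : F.Inside J := by
    induction h with
    | refl => exact hF
    | tail _ hs ih => exact ih.singlStep hs
  exact ⟨_, hJ.1 (Classical.arbitrary ι) x F.nonempty_index.some⟩

theorem Inside.rel_nonempty (hF : F.Inside I)
    (h : Relation.ReflTransGen (CSinglStep CSPInstance.BLPplusAIP) I J) (c : S.Con) :
    (J.rel c).Nonempty := by
  have hJ : F.Inside J := by
    induction h with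
    | refl => exact hF
    | tail _ hs ih => exact ih.cSinglStep hs
  exact ⟨_, hJ.2 (Classical.arbitrary ι) c F.nonempty_index.some⟩

theorem Inside.not_singlNo (hF : F.Inside I) : ¬ SinglNo CSPInstance.BLPplusAIP I := by
  rintro ⟨J, hJ, x, hx⟩
  exact (hF.domain_nonempty hJ x).ne_empty hx

theorem Inside.not_cSinglNo (hF : F.Inside I) : ¬ CSinglNo CSPInstance.BLPplusAIP I := by
  rintro ⟨J, hJ, c, hc⟩
  exact (hF.rel_nonempty hJ c).ne_empty hc

theorem Inside.singlYes (hF : F.Inside I) : SinglYes CSPInstance.BLPplusAIP I := by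
  obtain ⟨J, hJ, hs⟩ := exists_terminal_singlStep (Alg := CSPInstance.BLPplusAIP) I
  exact ⟨J, hJ, hs, hF.domain_nonempty hJ⟩

theorem Inside.cSinglYes (hF : F.Inside I) : CSinglYes CSPInstance.BLPplusAIP I := by
  obtain ⟨J, hJ, hs⟩ := exists_terminal_cSinglStep (Alg := CSPInstance.BLPplusAIP) I
  exact ⟨J, hJ, hs, hF.rel_nonempty hJ⟩

end SingletonFamily

end CSPInstance

/-! ### Answers on structures mapping to `A`, and reduction to stable "Yes" instances -/

section Soundness

open CSPInstance FirstOrder.Language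

universe u v w z

variable {L : FirstOrder.Language.{u, v}} [Finite ((n : ℕ) × L.Relations n)]
  {A : Type w} [Fintype A] [L.Structure A] {B : Type z} [L.Structure B]

/-- A homomorphism to `A` as a family with a single member. -/
def homFamily {X : Type} [Finite X] [L.Structure X] (h : X →[L] A) :
    SingletonFamily (pcspScheme L X) A Unit Unit where
  col _ c _ := h ∘ c.2.1
  val _ x _ := h x
  u _ := 1
  w _ := 1
  u_pos _ := one_pos
  sum_u := by simp
  sum_w := by simp
  col_eq_val _ _ _ := ⟨1, fun _ => rfl, fun _ => rfl, fun _ => rfl⟩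
  val_const _ _ _ := ⟨(), fun _ => rfl⟩
  col_const _ _ _ := ⟨(), fun _ => rfl⟩

theorem homFamily_inside {X : Type} [Finite X] [L.Structure X] (h : X →[L] A) :
    (homFamily h).Inside (pcspInstance L A X) := by
  classical
  exact ⟨fun _ _ _ => Finset.mem_univ _, fun _ c _ =>
    Finset.mem_filter.2 ⟨Finset.mem_univ _, h.map_rel c.1.2 c.2.1 c.2.2⟩⟩

/-- A homomorphism to `A` survives every removal, which settles the "Yes" side. Since runs can be
continued until they are stable, only the passage from a stable nonempty instance to a homomorphism
into `B` remains. -/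
theorem singlBLPAIPSolves_of_hom
    (H : ∀ (X : Type) [Finite X] [L.Structure X] (J : CSPInstance (pcspScheme L X) A),
      Relation.ReflTransGen (SinglStep BLPplusAIP) (pcspInstance L A X) J →
      (∀ K, ¬ SinglStep BLPplusAIP J K) → (∀ x, (J.D x).Nonempty) → Nonempty (X →[L] B)) :
    SinglBLPAIPSolves L A B := by
  intro X _ _
  refine ⟨fun ⟨h⟩ => ⟨(homFamily_inside h).singlYes, (homFamily_inside h).not_singlNo⟩,
    fun hB => ?_⟩
  have hyes : ¬ SinglYes BLPplusAIP (pcspInstance L A X) := fun ⟨J, h1, h2, h3⟩ =>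
    not_nonempty_iff.2 hB (H X J h1 h2 h3)
  refine ⟨?_, hyes⟩
  obtain ⟨J, h1, h2⟩ := exists_terminal_singlStep (Alg := BLPplusAIP) (pcspInstance L A X)
  refine ⟨J, h1, ?_⟩
  by_contra h
  push Not at h
  exact hyes ⟨J, h1, h2, h⟩

theorem cSinglBLPAIPSolves_of_hom
    (H : ∀ (X : Type) [Finite X] [L.Structure X] (J : CSPInstance (pcspScheme L X) A),
      Relation.ReflTransGen (CSinglStep BLPplusAIP) (pcspInstance L A X) J →
      (∀ K, ¬ CSinglStep BLPplusAIP J K) → (∀ c, (J.rel c).Nonempty) → Nonempty (X →[L] B)) :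
    CSinglBLPAIPSolves L A B := by
  intro X _ _
  refine ⟨fun ⟨h⟩ => ⟨(homFamily_inside h).cSinglYes, (homFamily_inside h).not_cSinglNo⟩,
    fun hB => ?_⟩
  have hyes : ¬ CSinglYes BLPplusAIP (pcspInstance L A X) := fun ⟨J, h1, h2, h3⟩ =>
    not_nonempty_iff.2 hB (H X J h1 h2 h3)
  refine ⟨?_, hyes⟩
  obtain ⟨J, h1, h2⟩ := exists_terminal_cSinglStep (Alg := BLPplusAIP) (pcspInstance L A X)
  refine ⟨J, h1, ?_⟩
  by_contra h
  push Not at h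
  exact hyes ⟨J, h1, h2, h⟩

end Soundness

section Palette

open CSPInstance FirstOrder.Language

universe u v w z

/-! ### Block permutations of palette tuples -/

theorem IsPalette.of_occ_eq {A : Type w} {ι : Type} {k : ι → ℕ} {P : Set (Set ι)}
    {a b : BlockTuple A k} (ha : IsPalette P a) (h : ∀ i, occ (a i) = occ (b i)) :
    IsPalette P b := by
  intro c hc
  choose σ hσ using fun i => exists_perm_of_occ_eq (h i).symm
  obtain ⟨i, j, hj⟩ := hc
  obtain ⟨G, hG, hGc⟩ := ha c ⟨i, σ i j, (hσ i j).symm.trans hj⟩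
  exact ⟨G, hG, fun i hi j => (hσ i j).trans (hGc i hi _)⟩

/-- Blocks of `a` are replaced by those of `b` one at a time; the intermediate tuples stay palette
because being palette depends only on the counts in the blocks. -/
theorem IsPaletteBlockSymmetric.eq_of_occ_eq {A : Type w} {B : Type z} {ι : Type} [Finite ι]
    {k : ι → ℕ} {P : Set (Set ι)} {f : BlockTuple A k → B} (hf : IsPaletteBlockSymmetric P f)
    {a b : BlockTuple A k} (ha : IsPalette P a) (h : ∀ i, occ (a i) = occ (b i)) : f a = f b := by
  classical
  have := Fintype.ofFinite ι
  suffices H : ∀ s : Finset ι, f (fun i => if i ∈ s then b i else a i) = f a by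
    simpa using (H Finset.univ).symm
  intro s
  induction s using Finset.induction_on with
  | empty => simp
  | insert i s hi ih =>
    rw [← ih]
    have hocc : ∀ s : Finset ι, ∀ i, occ (a i) = occ ((fun i => if i ∈ s then b i else a i) i) := by
      intro s i
      by_cases his : i ∈ s
      · simp [his, h i]
      · simp [his]
    refine (hf i _ _ (ha.of_occ_eq (hocc s)) (ha.of_occ_eq (hocc (insert i s))) ?_).symm
    intro g hg
    obtain ⟨σ, hσ⟩ := exists_perm_of_occ_eq (h i).symm
    have h1 := hg (fun i => if i ∈ s then b i else a i) σ (a i)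
    have h2 : a i ∘ σ = b i := funext fun k => (hσ k).symm
    simp only [h2] at h1
    convert h1.symm using 2
    · funext j
      by_cases hj : j = i
      · subst hj
        simp [hi]
      · simp [hj]
    · funext j
      by_cases hj : j = i
      · subst hj
        simp
      · simp [hj]

/-- The test function is the indicator of agreeing with `a` outside block `i` and having its counts
in block `i`; it needs two distinct values in `B`. -/
theorem occ_eq_of_indistinguishable {A : Type w} {B : Type z} [Nontrivial B] {ι : Type}
    {k : ι → ℕ} {i : ι} {a b : BlockTuple A k}
    (h : ∀ g : BlockTuple A k → B, BlockIsSymmetric g i → g a = g b) (p : ι) :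
    occ (a p) = occ (b p) := by
  classical
  obtain ⟨b₀, b₁, hb⟩ := exists_pair_ne B
  have := h (fun t => if (∀ q, q ≠ i → t q = a q) ∧ occ (t i) = occ (a i) then b₀ else b₁) (by
    intro c σ x
    have h1 : ∀ y : Fin (k i) → A, (∀ q, q ≠ i → Function.update c i y q = a q) ↔
        ∀ q, q ≠ i → c q = a q := fun y =>
      forall₂_congr fun q hq => by rw [Function.update_of_ne hq]
    simp only [h1, Function.update_self, occ_comp_perm])
  simp only [ne_eq, implies_true, and_self, if_true] at this
  by_cases hc : (∀ q, q ≠ i → b q = a q) ∧ occ (b i) = occ (a i)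
  · by_cases hp : p = i
    · subst hp
      exact hc.2.symm
    · rw [hc.1 p hp]
  · rw [if_neg hc] at this
    exact absurd this hb

variable {L : FirstOrder.Language.{u, v}} [L.IsRelational] [Finite ((n : ℕ) × L.Relations n)]
  {A : Type w} [Fintype A] [Nonempty A] [L.Structure A] {B : Type z} [L.Structure B]

/-! ### From polymorphisms to homomorphisms -/


/-- If there are palette block symmetric polymorphisms with many long blocks, then `X → B` as soon
as BLP+AIP says "Yes" on finitely many instances such that every value of a tuple of a constraint
is forced in one of them. -/
theorem nonempty_hom_of_BLPplusAIP
    (hpol : ∀ N : ℕ, ∃ n, N ≤ n ∧ ∃ k : Fin n → ℕ, (∀ i, 1 ≤ k i) ∧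
      ∃ m : (i : Fin n) × Fin (k i) → ℕ, (∀ p, N ≤ m p) ∧ HasPaletteBlockSymmetricPol L A B n k m)
    {X : Type} [Finite X] [L.Structure X] {Idx : Type*} [Finite Idx] [Nonempty Idx]
    (I : Idx → CSPInstance (pcspScheme L X) A) (hI : ∀ e, (I e).BLPplusAIP)
    (hrel : ∀ e c, ∀ a ∈ (I e).rel c, Structure.RelMap c.1.2 a)
    (hconst : ∀ e c i, ∀ a ∈ (I e).rel c, ∃ e', ∀ a' ∈ (I e').rel c, a' i = a i) :
    Nonempty (X →[L] B) := by
  classical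
  have := Fintype.ofFinite Idx
  choose N₀ hN₀ using fun e => (hI e).exists_tuples
  -- The first summand gives enough groups to cover all instances, the second makes every block long
  -- enough for whichever instance it serves.
  obtain ⟨n, hn, k, -, m, hm, f, hf, hsym⟩ := hpol (Fintype.card Idx + ∑ e, N₀ e)
  obtain ⟨φ, hφ⟩ : ∃ φ : Fin n → Idx, Function.Surjective φ := by
    obtain ⟨e⟩ := Function.Embedding.nonempty_of_card_le (α := Idx) (β := Fin n)
      (by rw [Fintype.card_fin]; omega)
    exact ⟨Function.invFun e, Function.invFun_surjective e.injective⟩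
  have hmN : ∀ p : (i : Fin n) × Fin (k i), N₀ (φ p.1) ≤ m p := fun p =>
    (Finset.single_le_sum (f := N₀) (fun _ _ => Nat.zero_le _) (Finset.mem_univ _)).trans
      ((Nat.le_add_left _ _).trans (hm p))
  choose g hg hocc using fun p => hN₀ (φ p.1) (m p) (hmN p)
  have hpal : ∀ (c : (pcspScheme L X).Con) (i : Fin ((pcspScheme L X).arity c)),
      IsPalette (Set.range fun i : Fin n => {p | p.1 = i}) (fun p j => g p c j i) := by
    rintro c i v ⟨p, j, rfl⟩
    obtain ⟨e, he⟩ := hconst _ c i _ (hg p c j)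
    obtain ⟨i', rfl⟩ := hφ e
    refine ⟨_, ⟨i', rfl⟩, fun q hq j' => he _ ?_⟩
    obtain rfl : q.1 = i' := hq
    exact hg q c j'
  -- A variable in no scope gets a default; otherwise any occurrence serves, as `hT` shows.
  let T : X → BlockTuple A m := fun x =>
    if h : ∃ q : (c : (pcspScheme L X).Con) × Fin ((pcspScheme L X).arity c),
        (pcspScheme L X).scope q.1 q.2 = x
    then fun p j => g p h.choose.1 j h.choose.2 else fun _ _ => Classical.arbitrary A
  have hT : ∀ (c : (pcspScheme L X).Con) (i : Fin ((pcspScheme L X).arity c)),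
      f (T ((pcspScheme L X).scope c i)) = f (fun p j => g p c j i) := by
    intro c i
    have h : ∃ q : (c : (pcspScheme L X).Con) × Fin ((pcspScheme L X).arity c),
        (pcspScheme L X).scope q.1 q.2 = (pcspScheme L X).scope c i := ⟨⟨c, i⟩, rfl⟩
    simp only [T, dif_pos h]
    exact hsym.eq_of_occ_eq (hpal _ _) fun p => hocc p _ _ _ _ h.choose_spec
  refine ⟨⟨fun x => f (T x), fun F => isEmptyElim F, fun {r} R x hx => ?_⟩⟩
  let c : (pcspScheme L X).Con := ⟨⟨r, R⟩, x, hx⟩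
  have := hf r R (fun t => g t.1 c t.2) fun t => hrel _ c _ (hg _ _ _)
  convert this using 1
  funext j
  exact hT c j

theorem nonempty_hom_of_isEmpty_con {X : Type} [Finite X] [L.Structure X] [Nonempty B]
    (h : IsEmpty (pcspScheme L X).Con) : Nonempty (X →[L] B) :=
  ⟨⟨fun _ => Classical.arbitrary B, fun F => isEmptyElim F, fun {r} R x hx =>
    h.elim ⟨⟨r, R⟩, x, hx⟩⟩⟩

theorem singlBLPAIPSolves_of_polymorphisms [Nonempty B] [IsEmpty (L.Relations 0)]
    (hpol : ∀ N : ℕ, ∃ n, N ≤ n ∧ ∃ k : Fin n → ℕ, (∀ i, 1 ≤ k i) ∧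
      ∃ m : (i : Fin n) × Fin (k i) → ℕ, (∀ p, N ≤ m p) ∧
        HasPaletteBlockSymmetricPol L A B n k m) :
    SinglBLPAIPSolves L A B := by
  classical
  refine singlBLPAIPSolves_of_hom fun X _ _ J hJ hstable hne => ?_
  by_cases hX : IsEmpty X
  · refine nonempty_hom_of_isEmpty_con ⟨?_⟩
    rintro ⟨⟨r, R⟩, x, -⟩
    cases r with
    | zero => exact isEmptyElim R
    | succ r => exact hX.elim (x 0)
  rw [not_isEmpty_iff] at hX
  have : Nonempty ((x : X) × {a // a ∈ J.D x}) :=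
    ⟨⟨hX.some, _, (hne hX.some).choose_spec⟩⟩
  refine nonempty_hom_of_BLPplusAIP hpol (Idx := (x : X) × {a // a ∈ J.D x})
    (fun e => J.reduceDomain e.1 {e.2.1}) (fun e => ?_) (fun e c a ha => ?_)
    fun e c i a ha => ?_
  · by_contra h
    exact hstable _ ⟨e.1, e.2.1, e.2.2, h, rfl⟩
  · exact (Finset.mem_filter.1 (rel_subset_of_singlSteps hJ c (Finset.mem_filter.1 ha).1)).2
  -- The value `a i` still lies in the domain of its variable, so fixing that variable to it is one
  -- of the indexed instances.
  · refine ⟨⟨(pcspScheme L X).scope c i, a i, J.rel_mem c a (Finset.mem_filter.1 ha).1 i⟩,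
      fun a' ha' => ?_⟩
    exact Finset.mem_singleton.1 ((Finset.mem_filter.1 ha').2 i rfl)

theorem cSinglBLPAIPSolves_of_polymorphisms [Nonempty B]
    (hpol : ∀ N : ℕ, ∃ n, N ≤ n ∧ ∃ k : Fin n → ℕ, (∀ i, 1 ≤ k i) ∧
      ∃ m : (i : Fin n) × Fin (k i) → ℕ, (∀ p, N ≤ m p) ∧
        HasPaletteBlockSymmetricPol L A B n k m) :
    CSinglBLPAIPSolves L A B := by
  classical
  refine cSinglBLPAIPSolves_of_hom fun X _ _ J hJ hstable hne => ?_
  by_cases hX : IsEmpty (pcspScheme L X).Con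
  · exact nonempty_hom_of_isEmpty_con hX
  rw [not_isEmpty_iff] at hX
  have : Nonempty ((c : (pcspScheme L X).Con) × {a // a ∈ J.rel c}) :=
    ⟨⟨hX.some, _, (hne hX.some).choose_spec⟩⟩
  have hsub := fun (e : (c : (pcspScheme L X).Con) × {a // a ∈ J.rel c}) c =>
    changeConstraint_rel_subset J e.1 c {e.2.1}
  refine nonempty_hom_of_BLPplusAIP hpol
    (Idx := (c : (pcspScheme L X).Con) × {a // a ∈ J.rel c})
    (fun e => J.changeConstraint e.1 {e.2.1}) (fun e => ?_) (fun e c a ha => ?_)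
    fun e c i a ha => ?_
  · by_contra h
    exact hstable _ ⟨e.1, e.2.1, e.2.2, h, rfl⟩
  · exact (Finset.mem_filter.1 (rel_subset_of_cSinglSteps hJ c (hsub e c ha))).2
  · refine ⟨⟨c, a, hsub e c ha⟩, fun a' ha' => ?_⟩
    simp only [changeConstraint, Function.update_self] at ha'
    rw [Finset.mem_singleton.1 (Finset.mem_inter.1 ha').2]

end Palette

section Completeness

open CSPInstance FirstOrder.Language

universe u v w z

/-! ### From the algorithms to polymorphisms -/

/-- `t` consists of tuples `t g`, and every element of `t` is the only element of some `t g`. -/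
def IsGroupPalette {ι P A : Type*} (t : ι → P → A) : Prop := ∀ i p, ∃ g, ∀ q, t g q = t i p

/-- The numbers of occurrences of the elements in the blocks of `t`. -/
noncomputable def blockOcc {ι J : Type*} {len : J → ℕ} {A : Type*}
    (t : ι → (j : J) × Fin (len j) → A) (i : ι) (j : J) : A → ℕ := occ fun k => t i ⟨j, k⟩

theorem IsGroupPalette.map {ι P A A' : Type*} {t : ι → P → A} (ht : IsGroupPalette t)
    (f : A → A') : IsGroupPalette fun i p => f (t i p) := fun i p => by
  obtain ⟨g, hg⟩ := ht i p
  exact ⟨g, fun q => congrArg f (hg q)⟩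

theorem exists_perm_of_blockOcc_eq {ι J : Type*} {len : J → ℕ} {A : Type*}
    {t t' : ι → (j : J) × Fin (len j) → A} (h : blockOcc t = blockOcc t') (i : ι) :
    ∃ σ : Equiv.Perm ((j : J) × Fin (len j)), (∀ p, (σ p).1 = p.1) ∧
      ∀ p, t i p = t' i (σ p) := by
  choose σ hσ using fun j => exists_perm_of_occ_eq (congrFun (congrFun h i) j)
  exact ⟨Equiv.sigmaCongrRight σ, fun _ => rfl, fun p => hσ p.1 p.2⟩

theorem sum_sigma_fin_fst {J F : Type*} [Fintype J] [Semiring F] {len : J → ℕ} (c : J → F) :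
    ∑ p : (j : J) × Fin (len j), c p.1 = ∑ j, len j * c j := by
  simp [Fintype.sum_sigma]

/-- Functions on the palette tuples with `ι` groups of blocks of lengths `len j` that are
block symmetric and preserve the relations. -/
def IsPartialPolymorphism (L : FirstOrder.Language.{u, v}) {A : Type w} [L.Structure A]
    {B : Type z} [L.Structure B] {ι J : Type*} {len : J → ℕ}
    (f : (ι → (j : J) × Fin (len j) → A) → B) : Prop :=
  (∀ t t', IsGroupPalette t → IsGroupPalette t' → blockOcc t = blockOcc t' → f t = f t') ∧
  ∀ (r : ℕ) (R : L.Relations r) (M : ι → (j : J) × Fin (len j) → Fin r → A),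
    (∀ i p, Structure.RelMap R (M i p)) → IsGroupPalette M →
    Structure.RelMap R fun j => f fun i p => M i p j

/-! ### Totalization by the Hales-Jewett theorem -/

/-- The tuple with additional groups of blocks given by the letters of a combinatorial subspace:
copies of groups of `t` for the letters of the alphabet and constant groups for the variables. -/
def extendBySubspace {ι P K A : Type*} (W : Combinatorics.Subspace (ι × P) ι K) (t : ι → P → A) :
    ι ⊕ K → P → A :=
  Sum.elim t fun k => (W.idxFun k).elim t fun e _ => t e.1 e.2

/-- Each variable `(i, p)` of the subspace occupies some coordinate by `W.proper`, and the group
there is constantly `t i p`. Nothing is required of `t`. -/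
theorem isGroupPalette_extendBySubspace {ι P K A : Type*}
    (W : Combinatorics.Subspace (ι × P) ι K) (t : ι → P → A) :
    IsGroupPalette (extendBySubspace W t) := by
  have key : ∀ i p, ∃ g, ∀ q, extendBySubspace W t g q = t i p := fun i p => by
    obtain ⟨k, hk⟩ := W.proper (i, p)
    exact ⟨Sum.inr k, fun q => by simp [extendBySubspace, hk]⟩
  rintro (i | k) p
  · exact key i p
  · rcases hk : W.idxFun k with i | e
    · simpa [extendBySubspace, hk] using key i p
    · simpa [extendBySubspace, hk] using key e.1 e.2

theorem map_extendBySubspace {ι P K A A' : Type*} (W : Combinatorics.Subspace (ι × P) ι K)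
    (t : ι → P → A) (f : A → A') :
    (fun i p => f (extendBySubspace W t i p)) = extendBySubspace W fun i p => f (t i p) := by
  funext i p
  rcases i with i | k
  · rfl
  · rcases hk : W.idxFun k with i | e <;> simp [extendBySubspace, hk]

/-- A palette tuple is extended as by a point of the subspace. -/
theorem IsGroupPalette.exists_extendBySubspace_eq {ι P K A : Type*}
    (W : Combinatorics.Subspace (ι × P) ι K) {t : ι → P → A} (ht : IsGroupPalette t) :
    ∃ x, extendBySubspace W t = Sum.elim t fun k => t (W x k) := by
  choose g hg using ht
  -- Send the variable `e` to a group on which `t` is constantly `t e.1 e.2`: the constant group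
  -- becomes a copy of that group.
  refine ⟨fun e => g e.1 e.2, ?_⟩
  funext i p
  rcases i with i | k
  · rfl
  · rcases hk : W.idxFun k with i | e
    · simp [extendBySubspace, hk, W.apply_inl hk]
    · simp [extendBySubspace, hk, W.apply_inr hk, hg]

/-- By the Hales-Jewett theorem, partial polymorphisms with many groups give polymorphisms that
are block symmetric on palette tuples. -/
theorem exists_total_of_isPartialPolymorphism {L : FirstOrder.Language.{u, v}}
    {A : Type w} [Finite A] [L.Structure A] {B : Type z} [L.Structure B] [Finite B] {ι J : Type} [Finite ι] [Finite J]
    {len : J → ℕ}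
    (h : ∀ (K : Type) [Finite K], ∃ f : (ι ⊕ K → (j : J) × Fin (len j) → A) → B,
      IsPartialPolymorphism L f) :
    ∃ f : (ι → (j : J) × Fin (len j) → A) → B,
      (∀ t t', IsGroupPalette t → IsGroupPalette t' → blockOcc t = blockOcc t' → f t = f t') ∧
      ∀ (r : ℕ) (R : L.Relations r) (M : ι → (j : J) × Fin (len j) → Fin r → A),
        (∀ i p, Structure.RelMap R (M i p)) → Structure.RelMap R fun j => f fun i p => M i p j := by
  obtain ⟨K, _, hK⟩ := Combinatorics.Subspace.exists_mono_in_high_dimension ι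
    ((ι → (j : J) × Fin (len j) → A) → B) (ι × (j : J) × Fin (len j))
  obtain ⟨f, hf1, hf2⟩ := h K
  -- The colour of a word is the whole function of `t` obtained by copying groups according to the
  -- word.
  obtain ⟨W, C, hW⟩ := hK fun w t => f (Sum.elim t fun k => t (w k))
  refine ⟨fun t => f (extendBySubspace W t), fun t t' ht ht' htt => ?_, fun r R M hM => ?_⟩
  · obtain ⟨x, hx⟩ := ht.exists_extendBySubspace_eq W
    obtain ⟨x', hx'⟩ := ht'.exists_extendBySubspace_eq W
    have hpal : ∀ (s : ι → (j : J) × Fin (len j) → A) (w : K → ι), IsGroupPalette s →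
        IsGroupPalette (Sum.elim s fun k => s (w k)) := by
      rintro s w hs (i | k) p
      · obtain ⟨g, hg⟩ := hs i p
        exact ⟨Sum.inl g, hg⟩
      · obtain ⟨g, hg⟩ := hs (w k) p
        exact ⟨Sum.inl g, hg⟩
    have h1 := congrFun (hW x) t'
    have h2 := congrFun (hW x') t'
    simp only [hx, hx']
    -- The points `x` and `x'` may differ: first pass from `t` to `t'` at the same point by
    -- symmetry, then change the point by monochromaticity.
    refine (hf1 _ _ (hpal t _ ht) (hpal t' _ ht') ?_).trans (h1.trans h2.symm)
    funext i j
    rcases i with i | k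
    · exact congrFun (congrFun htt i) j
    · exact congrFun (congrFun htt (W x k)) j
  · rw [← funext fun j => congrArg f (map_extendBySubspace W M fun a => a j)]
    refine hf2 r R (extendBySubspace W M) ?_ (isGroupPalette_extendBySubspace W M)
    · rintro (i | k) p
      · exact hM i p
      · rcases hk : W.idxFun k with i | e
        · simpa [extendBySubspace, hk] using hM i p
        · simpa [extendBySubspace, hk] using hM e.1 e.2

/-! ### The structure of palette tuples -/

section

variable {L : FirstOrder.Language.{u, v}} [L.IsRelational]
  {A : Type w} [Fintype A] [Nonempty A] [L.Structure A] {B : Type z} [L.Structure B]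

theorem exists_isPartialPolymorphism [Finite ((n : ℕ) × L.Relations n)]
    (hsolve : SinglBLPAIPSolves L A B ∨ CSinglBLPAIPSolves L A B)
    (ι : Type) [Finite ι] [Nonempty ι] (l : ℕ) :
    ∃ f : (ι → (j : Fin 2) × Fin (![l + 1, l] j) → A) → B, IsPartialPolymorphism L f := by
  classical
  let Pal := {t : ι → (j : Fin 2) × Fin (![l + 1, l] j) → A // IsGroupPalette t}
  -- A copy of `Pal` in `Type`, where inputs of the algorithms live.
  let X := Fin (Nat.card Pal)
  let rep : X ≃ Pal := (Finite.equivFin Pal).symm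
  let cls : X → ι → Fin 2 → A → ℕ := fun x => blockOcc (rep x).1
  have hcls : ∀ t, IsGroupPalette t → ∃ x, cls x = blockOcc t := fun t ht =>
    ⟨rep.symm ⟨t, ht⟩, by simp [cls]⟩
  let _ : L.Structure X :=
    { funMap := fun F => isEmptyElim F
      RelMap := fun {r} R x => ∃ M : ι → (j : Fin 2) × Fin (![l + 1, l] j) → Fin r → A,
        (∀ i p, Structure.RelMap R (M i p)) ∧ IsGroupPalette M ∧
        ∀ j, cls (x j) = blockOcc fun i p => M i p j }
  have hrel : ∀ c : (pcspScheme L X).Con,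
      ∃ M : ι → (j : Fin 2) × Fin (![l + 1, l] j) → Fin c.1.1 → A,
        (∀ i p, Structure.RelMap c.1.2 (M i p)) ∧ IsGroupPalette M ∧
        ∀ j, cls (c.2.1 j) = blockOcc fun i p => M i p j := fun c => c.2.2
  choose M hM1 hM2 hM3 using hrel
  let F : SingletonFamily (pcspScheme L X) A ι ((j : Fin 2) × Fin (![l + 1, l] j)) :=
    { col := fun g c => M c g
      val := fun g x => (rep x).1 g
      -- BLP is uniform on all `2 * l + 1` positions; AIP uses `1` on the longer block and `-1` on
      -- the shorter, with total `(l + 1) - l = 1`. Both are invariant under permutations inside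
      -- blocks.
      u := fun _ => 1 / (2 * l + 1)
      w := fun p => ![1, -1] p.1
      u_pos := fun _ => by positivity
      sum_u := by
        rw [sum_sigma_fin_fst fun _ => (1 / (2 * l + 1) : ℚ), Fin.sum_univ_two]
        simp only [Matrix.cons_val_zero, Matrix.cons_val_one]
        push_cast
        field_simp
        ring
      sum_w := by
        rw [sum_sigma_fin_fst ![1, -1], Fin.sum_univ_two]
        simp only [Matrix.cons_val_zero, Matrix.cons_val_one]
        push_cast
        ring
      col_eq_val := fun g c i => by
        obtain ⟨σ, h1, h2⟩ := exists_perm_of_blockOcc_eq (hM3 c i).symm g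
        exact ⟨σ, fun _ => rfl, fun p => by rw [h1], h2⟩
      val_const := fun x g p => (rep x).2 g p
      col_const := fun c g p => hM2 c g p }
  have hF : F.Inside (pcspInstance L A X) :=
    ⟨fun _ _ _ => Finset.mem_univ _, fun g c p =>
      Finset.mem_filter.2 ⟨Finset.mem_univ _, hM1 c g p⟩⟩
  obtain ⟨h⟩ : Nonempty (X →[L] B) := by
    by_contra hn
    rw [not_nonempty_iff] at hn
    rcases hsolve with hs | hs
    · exact hF.not_singlNo ((hs X).2 hn).1
    · exact hF.not_cSinglNo ((hs X).2 hn).1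
  have : Nonempty X := ⟨rep.symm ⟨fun _ _ => Classical.arbitrary A,
    fun _ _ => ⟨Classical.arbitrary ι, fun _ => rfl⟩⟩⟩
  -- Choosing one representative for each family of counts makes block symmetry automatic.
  refine ⟨fun t => h (Function.invFun cls (blockOcc t)), fun t t' _ _ htt => by simp only [htt],
    fun r R N hN1 hN2 => h.map_rel R _ ⟨N, hN1, hN2, fun j => ?_⟩⟩
  exact Function.invFun_eq (hcls _ (hN2.map fun a => a j))

theorem hasPaletteBlockSymmetricPol_of_solves [Finite ((n : ℕ) × L.Relations n)] [Finite B]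
    (hsolve : SinglBLPAIPSolves L A B ∨ CSinglBLPAIPSolves L A B) {l n : ℕ} (hn : 1 ≤ n) :
    HasPaletteBlockSymmetricPol L A B n (fun _ => 2) (fun p => ![l + 1, l] p.2) := by
  have : Nonempty (Fin n) := ⟨⟨0, hn⟩⟩
  obtain ⟨f, hf1, hf2⟩ := exists_total_of_isPartialPolymorphism (ι := Fin n)
    fun K _ => exists_isPartialPolymorphism hsolve (Fin n ⊕ K) l
  refine ⟨fun a => f fun i p => a ⟨i, p.1⟩ p.2, fun r R a ha =>
    hf2 r R (fun i p => a ⟨⟨i, p.1⟩, p.2⟩) fun i p => ha _, fun i a b ha hb hab => ?_⟩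
  -- With one element in `B` the test functions separate nothing, but then all values of `f`
  -- coincide.
  rcases subsingleton_or_nontrivial B with hB | hB
  · exact Subsingleton.elim _ _
  have hpal : ∀ a : BlockTuple A fun p : (i : Fin n) × Fin 2 => ![l + 1, l] p.2,
      IsPalette (Set.range fun i : Fin n => {p | p.1 = i}) a →
      IsGroupPalette fun (i : Fin n) (p : (j : Fin 2) × Fin (![l + 1, l] j)) =>
        a ⟨i, p.1⟩ p.2 := by
    intro a ha i p
    obtain ⟨_, ⟨g, rfl⟩, hg⟩ := ha _ ⟨⟨i, p.1⟩, p.2, rfl⟩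
    exact ⟨g, fun q => hg ⟨g, q.1⟩ rfl q.2⟩
  refine hf1 _ _ (hpal a ha) (hpal b hb) ?_
  funext i j
  exact occ_eq_of_indistinguishable hab ⟨i, j⟩

end

end Completeness

theorem mainTheorem1 (L : FirstOrder.Language) [L.IsRelational]
    [Finite ((n : ℕ) × L.Relations n)] [IsEmpty (L.Relations 0)]
    (A : Type*) [Fintype A] [Nonempty A] [L.Structure A]
    (B : Type*) [Finite B] [L.Structure B]
    (hAB : Nonempty (A →[L] B)) :
    [ SinglBLPAIPSolves L A B,
      CSinglBLPAIPSolves L A B,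
      ∀ l n : ℕ, 1 ≤ l → 1 ≤ n →
        HasPaletteBlockSymmetricPol L A B n (fun _ => 2) (fun p => ![l + 1, l] p.2),
      ∀ N : ℕ, ∃ n, N ≤ n ∧ ∃ k : Fin n → ℕ, (∀ i, 1 ≤ k i) ∧
        ∃ m : (i : Fin n) × Fin (k i) → ℕ, (∀ p, N ≤ m p) ∧
          HasPaletteBlockSymmetricPol L A B n k m ].TFAE := by
  have hB : Nonempty B := hAB.map fun h => h (Classical.arbitrary A)
  tfae_have 1 → 3 := fun h l n _ hn => hasPaletteBlockSymmetricPol_of_solves (.inl h) hn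
  tfae_have 2 → 3 := fun h l n _ hn => hasPaletteBlockSymmetricPol_of_solves (.inr h) hn
  tfae_have 3 → 4 := fun h N => by
    -- `N + 1` keeps both parameters positive when `N = 0`.
    refine ⟨N + 1, N.le_succ, fun _ => 2, fun _ => one_le_two, _, ?_,
      h (N + 1) (N + 1) N.succ_pos N.succ_pos⟩
    rintro ⟨i, j⟩
    fin_cases j
    · exact (N.le_succ.trans (N + 1).le_succ)
    · exact N.le_succ
  tfae_have 4 → 1 := singlBLPAIPSolves_of_polymorphisms
  tfae_have 4 → 2 := cSinglBLPAIPSolves_of_polymorphisms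
  tfae_finish
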